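/- Let $T,L>0$, $J\ge 0$, $a_0,\dots,a_J\in\mathbb C$, and consider the channel $$\partial_z q(z,t)=\sum_{j=0}^J a_j\,\partial_t^j q(z,t)+n(z,t),\qquad 0\le z\le L,\ -T\le t\le T,$$ with channel polynomial $R(x)=\sum_{j=0}^J a_jx^j$. Identify functions on $[-T,T]$ that match at the ends with their $2T$-periodic extensions. A trajectory with control $n$ is a function $q$ that satisfies this equation for $0\le z\le L$, where $q(z,\cdot)$ is $2T$-periodic and $C^J$, and where $n$ and $\partial_t^jq$ $(0\le j\le J)$ are continuous in $(z,t)$; its effort is $\int_0^L\int_{-T}^T|n|^2\,dt\,dz$. Let the input and output alphabets both be the space $\mathcal W$ of $C^J$ functions of bounded variation on $[-T,T]$ that vanish at $\pm T$ with all their derivatives up to order $J$, or any larger complex linear space of functions. For $x\in\mathcal W$ let $B_E(x)$ be the set of all $y\in\mathcal W$ for which there is a trajectory with $q(0,\cdot)=x$, $q(L,\cdot)=y$ and effort at most $E$, and let $d(x_1,x_2)=\inf\{E: B_E(x_1)\cap B_E(x_2)\ne\varnothing\}$. Let $x_1,x_2\in\mathcal W$, and let $q$ (from $q(0,\cdot)=x_1$)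 and $p$ (from $p(0,\cdot)=x_2$) be trajectories that minimize the effort needed to confuse $x_1$ and $x_2$: $q(L,\cdot)=p(L,\cdot)\in\mathcal W$, and both efforts are at most $d(x_1,x_2)$. Put $\omega_m=m\pi/T$ and $R_m=R(i\omega_m)$, and let $Q_m(z)$, $P_m(z)$, $X^{(k)}_m$ $(m\in\mathbb Z)$ be the Fourier coefficients on $[-T,T]$ of $q(z,\cdot)$, $p(z,\cdot)$, $x_k$ with respect to $e^{i\omega_mt}$. Then there are complex numbers $A_m,B_m,C_m,D_m$ $(m\in\mathbb Z)$ and a real number $\mu$ such that for all $m$ and all $z\in[0,L]$ $$Q_m(z)=\begin{cases}(A_m+B_mz)e^{R_mz}&\text{if }\Re R_m=0,\\ A_me^{R_mz}+B_me^{-R_m^*z}&\text{otherwise,}\end{cases}\qquad P_m(z)=\begin{cases}(C_m+D_mz)e^{R_mz}&\text{if }\Re R_m=0,\\ C_me^{R_mz}+D_me^{-R_m^*z}&\text{otherwise,}\end{cases}$$ $$Q_m(0)=X^{(1)}_m,\qquad P_m(0)=X^{(2)}_m,\qquad Q_m(L)=P_m(L),\qquad (1-\mu)B_m+\mu D_m=0,$$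 and $$\sum_{m\in\mathbb Z} f(R_m)\left(|B_m|^2-|D_m|^2\right)=0,\qquad f(x)=\begin{cases}c&\text{if }\Re x=0,\\ (x+x^*)\left(e^{-L(x+x^*)}-1\right)&\text{otherwise,}\end{cases}$$ both for $c=1$ and for $c=-L$ (with the latter, the sum is, up to a constant factor, the difference of the two efforts). -/

import Mathlib

open Set MeasureTheory

noncomputable section

namespace LinearChannel

/-! Waveforms on `[-T, T]` are represented by their `2T`-periodic extensions `ℝ → ℂ`. -/

theorem boundedVariationOn_add {f g : ℝ → ℂ} {s : Set ℝ} (hf : BoundedVariationOn f s)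
    (hg : BoundedVariationOn g s) : BoundedVariationOn (f + g) s := by
  have h : eVariationOn (f + g) s ≤ eVariationOn f s + eVariationOn g s := by
    refine iSup_le fun p => ?_
    calc ∑ i ∈ Finset.range p.1, edist ((f + g) (p.2.1 (i + 1))) ((f + g) (p.2.1 i))
        ≤ ∑ i ∈ Finset.range p.1, (edist (f (p.2.1 (i + 1))) (f (p.2.1 i))
            + edist (g (p.2.1 (i + 1))) (g (p.2.1 i))) :=
          Finset.sum_le_sum fun i _ => edist_add_add_le _ _ _ _
      _ ≤ eVariationOn f s + eVariationOn g s := by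
          rw [Finset.sum_add_distrib]
          exact add_le_add (le_iSup_of_le p le_rfl) (le_iSup_of_le p le_rfl)
  exact ne_top_of_le_ne_top (ENNReal.add_ne_top.2 ⟨hf, hg⟩) h

/-- The alphabet of `J` times continuously differentiable waveforms on `[-T, T]` that satisfy the
Dirichlet (bounded variation) condition and vanish at `t = ± T` together with all their derivatives
(of order at most `J`). For a `2T`-periodic function `t = -T` and `t = T` are the same point. -/
def alphabet (T : ℝ) (J : ℕ) : Submodule ℂ (ℝ → ℂ) where
  carrier := {x | Function.Periodic x (2 * T) ∧ ContDiff ℝ J x ∧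
    BoundedVariationOn x (Icc (-T) T) ∧ ∀ j ≤ J, iteratedDeriv j x T = 0}
  zero_mem' := by
    refine ⟨fun _ => rfl, contDiff_const, ?_, fun j _ => ?_⟩
    · have h : eVariationOn (0 : ℝ → ℂ) (Icc (-T) T) = 0 :=
        eVariationOn.constant_on (by
          rintro _ ⟨_, _, rfl⟩ _ ⟨_, _, rfl⟩
          rfl)
      simp [BoundedVariationOn, h]
    · simp
  add_mem' := by
    rintro x y ⟨hx1, hx2, hx3, hx4⟩ ⟨hy1, hy2, hy3, hy4⟩
    refine ⟨hx1.add hy1, hx2.add hy2, boundedVariationOn_add hx3 hy3, fun j hj => ?_⟩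
    have hj' : (j : WithTop ℕ∞) ≤ J := by exact_mod_cast hj
    rw [iteratedDeriv_add (hx2.of_le hj').contDiffAt (hy2.of_le hj').contDiffAt, hx4 j hj,
      hy4 j hj, add_zero]
  smul_mem' := by
    rintro c x ⟨hx1, hx2, hx3, hx4⟩
    refine ⟨fun t => congrArg (c • ·) (hx1 t), hx2.const_smul c, ?_, fun j hj => ?_⟩
    · exact (lipschitzWith_smul c).comp_boundedVariationOn hx3
    · have hj' : (j : WithTop ℕ∞) ≤ J := by exact_mod_cast hj
      rw [iteratedDeriv_const_smul (hx2.of_le hj').contDiffAt, hx4 j hj, smul_zero]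

/-- The channel polynomial `R(x) = ∑_{j ≤ J} a_j x ^ j`. -/
def channelPoly (J : ℕ) (a : ℕ → ℂ) : Polynomial ℂ :=
  ∑ j ∈ Finset.range (J + 1), Polynomial.C (a j) * Polynomial.X ^ j

/-- `R(i ω_m)` with `ω_m = m π / T`. -/
def symbol (T : ℝ) (J : ℕ) (a : ℕ → ℂ) (m : ℤ) : ℂ :=
  (channelPoly J a).eval (Complex.I * ((m * Real.pi / T : ℝ) : ℂ))

/-- `q` is a (classical) trajectory of `∂q/∂z = ∑_{j ≤ J} a_j ∂^j q/∂t^j + n`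
on `0 ≤ z ≤ L` with the continuous control `n`. The state is `2T`-periodic in `t`. -/
structure IsTrajectory (T L : ℝ) (J : ℕ) (a : ℕ → ℂ) (n q : ℝ → ℝ → ℂ) : Prop where
  periodic : ∀ z ∈ Icc 0 L, Function.Periodic (q z) (2 * T)
  contDiff : ∀ z ∈ Icc 0 L, ContDiff ℝ J (q z)
  continuousOn_deriv : ∀ j ≤ J,
    ContinuousOn (fun w : ℝ × ℝ => iteratedDeriv j (q w.1) w.2) (Icc 0 L ×ˢ univ)
  continuousOn_noise : ContinuousOn (fun w : ℝ × ℝ => n w.1 w.2) (Icc 0 L ×ˢ univ)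
  evolution : ∀ z ∈ Icc 0 L, ∀ t : ℝ,
    HasDerivWithinAt (fun s => q s t)
      (∑ j ∈ Finset.range (J + 1), a j * iteratedDeriv j (q z) t + n z t) (Icc 0 L) z

/-- The effort `∫_0^L ∫_{-T}^T |n(z,t)|² dt dz`. -/
def effort (T L : ℝ) (n : ℝ → ℝ → ℂ) : ℝ :=
  ∫ z in (0 : ℝ)..L, ∫ t in (-T)..T, ‖n z t‖ ^ 2

/-- `S_E(x)`: the outputs in the alphabet `W` into which `x` can be transformed
with effort exactly `E`. -/
def outputsAt (T L : ℝ) (J : ℕ) (a : ℕ → ℂ) (W : Submodule ℂ (ℝ → ℂ)) (E : ℝ) (x : ℝ → ℂ) :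
    Set (ℝ → ℂ) :=
  {y | y ∈ W ∧ ∃ n q : ℝ → ℝ → ℂ, IsTrajectory T L J a n q ∧ q 0 = x ∧ q L = y ∧
    effort T L n = E}

/-- The noise ball `B_E(x) = ⋃_{ε ≤ E} S_ε(x)`. -/
def noiseBall (T L : ℝ) (J : ℕ) (a : ℕ → ℂ) (W : Submodule ℂ (ℝ → ℂ)) (E : ℝ) (x : ℝ → ℂ) :
    Set (ℝ → ℂ) :=
  ⋃ (ε : ℝ) (_ : ε ≤ E), outputsAt T L J a W ε x

/-- The effort needed to confuse `x₁` and `x₂`, that is, their adversarial distance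
`inf {E | B_E(x₁) ∩ B_E(x₂) ≠ ∅}`. -/
def advDist (T L : ℝ) (J : ℕ) (a : ℕ → ℂ) (W : Submodule ℂ (ℝ → ℂ)) (x₁ x₂ : ℝ → ℂ) : ℝ :=
  sInf {E : ℝ | (noiseBall T L J a W E x₁ ∩ noiseBall T L J a W E x₂).Nonempty}

/-- The trajectories `q` (from `x₁`, control `n₁`) and `p` (from `x₂`, control `n₂`) end in the
same output and attain the minimal effort needed to confuse `x₁` and `x₂`. -/
structure IsMinimizingPair (T L : ℝ) (J : ℕ) (a : ℕ → ℂ) (W : Submodule ℂ (ℝ → ℂ))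
    (x₁ x₂ : ℝ → ℂ) (n₁ n₂ q p : ℝ → ℝ → ℂ) : Prop where
  left : IsTrajectory T L J a n₁ q
  right : IsTrajectory T L J a n₂ p
  left_start : q 0 = x₁
  right_start : p 0 = x₂
  end_eq : q L = p L
  end_mem : q L ∈ W
  left_effort : effort T L n₁ ≤ advDist T L J a W x₁ x₂
  right_effort : effort T L n₂ ≤ advDist T L J a W x₁ x₂

/-- The mode `(A + B z) e^{r z}` if `Re r = 0`, and `A e^{r z} + B e^{- r^* z}` otherwise. -/
def mode (r A B : ℂ) (z : ℝ) : ℂ :=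
  open Classical in
  if r.re = 0 then (A + B * z) * Complex.exp (r * z)
  else A * Complex.exp (r * z) + B * Complex.exp (-(starRingEnd ℂ r) * z)

/-- `c` if `Re r = 0`, and `(r + r^*) (e^{-L (r + r^*)} - 1)` otherwise; `r + r^* = 2 Re r`.
For `c = -L`, the number `- weight L c r * |B|²` is the effort `∫_0^L |u' - r u|² dz` of the mode
`u = mode r A B`. -/
def weight (L c : ℝ) (r : ℂ) : ℝ :=
  open Classical in
  if r.re = 0 then c else (2 * r.re) * (Real.exp (-L * (2 * r.re)) - 1)

end LinearChannel

end

/-! The pair minimizes the larger of two quadratic efforts over an affine family of trajectory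
pairs. Moving along a variation changes each effort by a linear term `2 Re ∫ n_i^* ν_i` plus a
quadratic one, so no variation can lower both efforts below `d`. This yields multipliers `μ₁, μ₂ ≥
0` with sum 1, complementary slackness, and `μ₁ Re⟨n₁, ν₁⟩ + μ₂ Re⟨n₂, ν₂⟩ = 0` for all admissible
variations (`IsMinimizingPair.exists_multipliers`).

Giving both trajectories the same variation makes `μ₁ n₁ + μ₂ n₂` stationary under variations whose
end moves freely in the alphabet. Such a control has vanishing Fourier coefficients
(`fourierCoeffOn_eq_zero_of_stationary`): the Euler-Lagrange equation reduces the claim to `z = L`,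
and there the end condition, tested on functions that vanish to order `J + 1` at `± T`, gives a
recurrence without nonzero null solutions. By Parseval `μ₁² E₁ = μ₂² E₂`, and slackness turns this
into `d (μ₁ - μ₂) = 0`. Either `d = 0` and both controls vanish, or `μ₁ = μ₂ = 1/2` and the controls
have opposite coefficients.

In both cases the `m`-th coefficients of the controls are `± β_m e^{-R_m^* z}`
(`IsMinimizingPair.fourierCoeffOn_noise`). The coefficients of the trajectories solve the scalar
equation `u' = R_m u ± β_m e^{-R_m^* z}`, whose solutions are the stated modes (`eq_mode`), with
`D_m = -B_m`. Hence `μ = 1/2` works, and both sums vanish term by term. -/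

namespace LinearChannel

open ComplexConjugate

/-! ### Fourier modes and the pairing of controls -/

/-- The mode `t ↦ e^{i ω_m t}`, `ω_m = m π / T`. -/
noncomputable def expMode (T : ℝ) (m : ℤ) (t : ℝ) : ℂ :=
  Complex.exp (Complex.I * ((m * Real.pi / T : ℝ) : ℂ) * t)

/-- The pairing `∫_0^L ∫_{-T}^T f^* g dt dz` of two controls. -/
noncomputable def pairing (T L : ℝ) (f g : ℝ → ℝ → ℂ) : ℂ :=
  ∫ z in (0 : ℝ)..L, ∫ t in (-T)..T, conj (f z t) * g z t

theorem continuous_expMode (T : ℝ) (m : ℤ) : Continuous (expMode T m) := by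
  unfold expMode; fun_prop

theorem contDiff_expMode (T : ℝ) (m : ℤ) {k : WithTop ℕ∞} : ContDiff ℝ k (expMode T m) := by
  unfold expMode
  exact (contDiff_const.mul Complex.ofRealCLM.contDiff).cexp

theorem hasDerivAt_expMode (T : ℝ) (m : ℤ) (t : ℝ) : HasDerivAt (expMode T m)
    (Complex.I * ((m * Real.pi / T : ℝ) : ℂ) * expMode T m t) t := by
  unfold expMode
  have h := ((Complex.ofRealCLM.hasDerivAt (x := t)).const_mul
    (Complex.I * ((m * Real.pi / T : ℝ) : ℂ))).cexp
  simpa [mul_comm] using h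

theorem iteratedDeriv_expMode (T : ℝ) (m : ℤ) (j : ℕ) : iteratedDeriv j (expMode T m) =
    fun t => (Complex.I * ((m * Real.pi / T : ℝ) : ℂ)) ^ j * expMode T m t := by
  induction j with
  | zero => simp
  | succ j ih =>
    rw [iteratedDeriv_succ, ih]
    funext t
    rw [((hasDerivAt_expMode T m t).const_mul _).deriv]
    ring

theorem expMode_mul (T : ℝ) (m k : ℤ) (t : ℝ) :
    expMode T m t * expMode T k t = expMode T (m + k) t := by
  unfold expMode
  rw [← Complex.exp_add]
  congr 1
  push_cast
  ring

theorem expMode_periodic {T : ℝ} (hT : 0 < T) (m : ℤ) :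
    Function.Periodic (expMode T m) (2 * T) := by
  intro t
  unfold expMode
  rw [Complex.exp_eq_exp_iff_exists_int]
  refine ⟨m, ?_⟩
  have : (T : ℂ) ≠ 0 := by exact_mod_cast hT.ne'
  push_cast
  field_simp

theorem expMode_one_end {T : ℝ} (hT : 0 < T) : expMode T 1 T = -1 := by
  unfold expMode
  have : (T : ℂ) ≠ 0 := by exact_mod_cast hT.ne'
  rw [← Complex.exp_pi_mul_I]
  congr 1
  push_cast
  field_simp

theorem conj_expMode (T : ℝ) (m : ℤ) (t : ℝ) : conj (expMode T m t) = expMode T (-m) t := by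
  unfold expMode
  rw [← Complex.exp_conj]
  congr 1
  simp
  ring

theorem fourierCoeffOn_eq_expMode {T : ℝ} (hT : 0 < T) (f : ℝ → ℂ) (m : ℤ) :
    fourierCoeffOn (neg_lt_self hT) f m
      = (1 / (2 * T) : ℂ) * ∫ t in (-T)..T, conj (expMode T m t) * f t := by
  rw [fourierCoeffOn_eq_integral, Complex.real_smul]
  have hT' : (T : ℂ) ≠ 0 := by exact_mod_cast hT.ne'
  congr 1
  · push_cast; ring
  · congr 1
    funext t
    rw [smul_eq_mul, fourier_coe_apply, conj_expMode]
    congr 1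
    unfold expMode
    congr 1
    push_cast
    field_simp
    ring_nf

/-! ### Iterated integrals over the strip and the sesquilinear pairing. -/

theorem intervalIntegral_continuousOn {E : Type*} [NormedAddCommGroup E] [NormedSpace ℝ E]
    {L : ℝ} (hL : 0 ≤ L) {f : ℝ → ℝ → E} (a b : ℝ)
    (hf : ContinuousOn (fun w : ℝ × ℝ => f w.1 w.2) (Icc 0 L ×ˢ univ)) :
    ContinuousOn (fun z => ∫ t in a..b, f z t) (Icc 0 L) := by
  -- Clamping `z` to `[0, L]` extends the integrand to a continuous function on the whole plane.
  have hg : Continuous (Function.uncurry fun z t => f (projIcc 0 L hL z) t) := by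
    have h : Continuous fun w : ℝ × ℝ => (((projIcc 0 L hL w.1 : Icc 0 L) : ℝ), w.2) :=
      (continuous_subtype_val.comp (continuous_projIcc.comp continuous_fst)).prodMk continuous_snd
    exact hf.comp_continuous h fun w => ⟨(projIcc 0 L hL w.1).2, mem_univ _⟩
  have h := intervalIntegral.continuous_parametric_intervalIntegral_of_continuous' (μ := volume)
    hg a b
  refine h.continuousOn.congr fun z hz => ?_
  simp only [projIcc_of_mem hL hz]

theorem slice_continuous {E : Type*} [TopologicalSpace E] {L : ℝ} {f : ℝ → ℝ → E}
    (hf : ContinuousOn (fun w : ℝ × ℝ => f w.1 w.2) (Icc 0 L ×ˢ univ)) {z : ℝ}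
    (hz : z ∈ Icc 0 L) : Continuous (f z) :=
  hf.comp_continuous (f := fun t : ℝ => (z, t)) (by fun_prop) fun _ => ⟨hz, mem_univ _⟩

theorem intervalIntegrable_of_continuousOn_Icc {E : Type*} [NormedAddCommGroup E]
    {L : ℝ} (hL : 0 ≤ L) {f : ℝ → E} (hf : ContinuousOn f (Icc 0 L)) :
    IntervalIntegrable f volume 0 L :=
  ContinuousOn.intervalIntegrable (by rwa [uIcc_of_le hL])

theorem iterated_integral_add {E : Type*} [NormedAddCommGroup E] [NormedSpace ℝ E]
    {T L : ℝ} (hL : 0 ≤ L) {f g : ℝ → ℝ → E}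
    (hf : ContinuousOn (fun w : ℝ × ℝ => f w.1 w.2) (Icc 0 L ×ˢ univ))
    (hg : ContinuousOn (fun w : ℝ × ℝ => g w.1 w.2) (Icc 0 L ×ˢ univ)) :
    ∫ z in (0 : ℝ)..L, ∫ t in (-T)..T, (f z t + g z t)
      = (∫ z in (0 : ℝ)..L, ∫ t in (-T)..T, f z t) + ∫ z in (0 : ℝ)..L, ∫ t in (-T)..T, g z t := by
  rw [← intervalIntegral.integral_add
    (intervalIntegrable_of_continuousOn_Icc hL (intervalIntegral_continuousOn hL _ _ hf))
    (intervalIntegrable_of_continuousOn_Icc hL (intervalIntegral_continuousOn hL _ _ hg))]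
  refine intervalIntegral.integral_congr fun z hz => ?_
  rw [uIcc_of_le hL] at hz
  exact intervalIntegral.integral_add ((slice_continuous hf hz).intervalIntegrable _ _)
    ((slice_continuous hg hz).intervalIntegrable _ _)

theorem continuousOn_conj_mul {S : Set (ℝ × ℝ)} {f g : ℝ → ℝ → ℂ}
    (hf : ContinuousOn (fun w : ℝ × ℝ => f w.1 w.2) S)
    (hg : ContinuousOn (fun w : ℝ × ℝ => g w.1 w.2) S) :
    ContinuousOn (fun w : ℝ × ℝ => conj (f w.1 w.2) * g w.1 w.2) S :=
  (Complex.continuous_conj.comp_continuousOn hf).mul hg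

theorem pairing_add_right {T L : ℝ} (hL : 0 ≤ L) {f g h : ℝ → ℝ → ℂ}
    (hf : ContinuousOn (fun w : ℝ × ℝ => f w.1 w.2) (Icc 0 L ×ˢ univ))
    (hg : ContinuousOn (fun w : ℝ × ℝ => g w.1 w.2) (Icc 0 L ×ˢ univ))
    (hh : ContinuousOn (fun w : ℝ × ℝ => h w.1 w.2) (Icc 0 L ×ˢ univ)) :
    pairing T L f (g + h) = pairing T L f g + pairing T L f h := by
  unfold pairing
  rw [← iterated_integral_add hL (continuousOn_conj_mul hf hg) (continuousOn_conj_mul hf hh)]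
  simp only [Pi.add_apply, mul_add]

theorem pairing_add_left {T L : ℝ} (hL : 0 ≤ L) {f g h : ℝ → ℝ → ℂ}
    (hf : ContinuousOn (fun w : ℝ × ℝ => f w.1 w.2) (Icc 0 L ×ˢ univ))
    (hg : ContinuousOn (fun w : ℝ × ℝ => g w.1 w.2) (Icc 0 L ×ˢ univ))
    (hh : ContinuousOn (fun w : ℝ × ℝ => h w.1 w.2) (Icc 0 L ×ˢ univ)) :
    pairing T L (f + g) h = pairing T L f h + pairing T L g h := by
  unfold pairing
  rw [← iterated_integral_add hL (continuousOn_conj_mul hf hh) (continuousOn_conj_mul hg hh)]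
  simp only [Pi.add_apply, map_add, add_mul]

theorem pairing_smul_right (T L : ℝ) (c : ℂ) (f g : ℝ → ℝ → ℂ) :
    pairing T L f (c • g) = c * pairing T L f g := by
  unfold pairing
  simp only [Pi.smul_apply, smul_eq_mul, mul_left_comm _ c, intervalIntegral.integral_const_mul]

theorem pairing_smul_left (T L : ℝ) (c : ℂ) (f g : ℝ → ℝ → ℂ) :
    pairing T L (c • f) g = conj c * pairing T L f g := by
  unfold pairing
  simp only [Pi.smul_apply, smul_eq_mul, map_mul, mul_assoc, intervalIntegral.integral_const_mul]

theorem pairing_self (T L : ℝ) (f : ℝ → ℝ → ℂ) : pairing T L f f = effort T L f := by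
  unfold pairing effort
  simp only [Complex.conj_mul', ← Complex.ofReal_pow, intervalIntegral.integral_ofReal]

theorem pairing_conj_symm (T L : ℝ) (f g : ℝ → ℝ → ℂ) :
    pairing T L f g = conj (pairing T L g f) := by
  unfold pairing
  simp only [← intervalIntegral.intervalIntegral_conj, map_mul, Complex.conj_conj, mul_comm]

theorem effort_add_smul {T L : ℝ} (hL : 0 ≤ L) {f g : ℝ → ℝ → ℂ}
    (hf : ContinuousOn (fun w : ℝ × ℝ => f w.1 w.2) (Icc 0 L ×ˢ univ))
    (hg : ContinuousOn (fun w : ℝ × ℝ => g w.1 w.2) (Icc 0 L ×ˢ univ)) (ε : ℝ) :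
    effort T L (f + (ε : ℂ) • g)
      = effort T L f + ε * (2 * (pairing T L f g).re + ε * effort T L g) := by
  have hg' : ContinuousOn (fun w : ℝ × ℝ => ((ε : ℂ) • g) w.1 w.2) (Icc 0 L ×ˢ univ) :=
    continuousOn_const.mul hg
  have h := pairing_self T L (f + (ε : ℂ) • g)
  rw [pairing_add_left hL hf hg' (hf.add hg'), pairing_add_right hL hf hf hg',
    pairing_add_right hL hg' hf hg', pairing_smul_right, pairing_smul_left, pairing_smul_left,
    pairing_smul_right, pairing_conj_symm T L g f, pairing_self, pairing_self] at h
  have h2 := congrArg Complex.re h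
  simp [-Complex.coe_smul] at h2
  rw [← h2]
  ring

theorem effort_nonneg {T L : ℝ} (hT : 0 ≤ T) (hL : 0 ≤ L) (f : ℝ → ℝ → ℂ) :
    0 ≤ effort T L f :=
  intervalIntegral.integral_nonneg hL fun _ _ =>
    intervalIntegral.integral_nonneg (by linarith) fun _ _ => by positivity

theorem continuousOn_fourierCoeffOn {T L : ℝ} (hT : 0 < T) (hL : 0 ≤ L) {f : ℝ → ℝ → ℂ}
    (hf : ContinuousOn (fun w : ℝ × ℝ => f w.1 w.2) (Icc 0 L ×ˢ univ)) (m : ℤ) :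
    ContinuousOn (fun z => fourierCoeffOn (neg_lt_self hT) (f z) m) (Icc 0 L) := by
  simp only [fourierCoeffOn_eq_expMode hT]
  refine continuousOn_const.mul (intervalIntegral_continuousOn hL _ _ ?_)
  have h := continuous_expMode T m
  exact continuousOn_conj_mul (f := fun _ t => expMode T m t)
    (h.comp continuous_snd).continuousOn hf

/-- Orthogonality in `t` is built into the Fourier coefficient, so testing against one mode leaves a
one-dimensional integral in `z`; `2T` undoes the normalization of the coefficient. -/
theorem pairing_mode {T L : ℝ} (hT : 0 < T) (f : ℝ → ℝ → ℂ) (m : ℤ) (φ : ℝ → ℂ) :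
    pairing T L f (fun z t => φ z * expMode T m t)
      = 2 * T * ∫ z in (0 : ℝ)..L, conj (fourierCoeffOn (neg_lt_self hT) (f z) m) * φ z := by
  unfold pairing
  rw [← intervalIntegral.integral_const_mul]
  congr 1
  funext z
  rw [fourierCoeffOn_eq_expMode hT, map_mul, ← intervalIntegral.intervalIntegral_conj]
  have hT' : (T : ℂ) ≠ 0 := by exact_mod_cast hT.ne'
  simp only [mul_left_comm _ (φ z), intervalIntegral.integral_const_mul, map_mul,
    Complex.conj_conj, mul_comm (conj (f z _))]
  rw [map_div₀, map_one, map_mul, Complex.conj_ofReal, map_ofNat]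
  field_simp

theorem hasSum_sq_fourierCoeffOn_continuous {T : ℝ} (hT : 0 < T) {f : ℝ → ℂ}
    (hf : Continuous f) : HasSum (fun m => ‖fourierCoeffOn (neg_lt_self hT) f m‖ ^ 2)
      ((2 * T)⁻¹ * ∫ t in (-T)..T, ‖f t‖ ^ 2) := by
  have h : MemLp f 2 (volume.restrict (Ioc (-T) T)) := by
    refine (memLp_two_iff_integrable_sq_norm hf.aestronglyMeasurable).2 ?_
    exact (hf.norm.pow 2).integrableOn_Ioc
  have h2 := hasSum_sq_fourierCoeffOn (neg_lt_self hT) h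
  rwa [smul_eq_mul, show T - -T = 2 * T by ring] at h2

/-! ### Trajectories -/

theorem symbol_eq_sum (T : ℝ) (J : ℕ) (a : ℕ → ℂ) (m : ℤ) : symbol T J a m =
    ∑ j ∈ Finset.range (J + 1), a j * (Complex.I * ((m * Real.pi / T : ℝ) : ℂ)) ^ j := by
  simp [symbol, channelPoly, Polynomial.eval_finsetSum]

theorem IsTrajectory.add {T L : ℝ} {J : ℕ} {a : ℕ → ℂ} {n q n' q' : ℝ → ℝ → ℂ}
    (h : IsTrajectory T L J a n q) (h' : IsTrajectory T L J a n' q') :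
    IsTrajectory T L J a (n + n') (q + q') := by
  have key : ∀ j ≤ J, ∀ z ∈ Icc 0 L, ∀ t, iteratedDeriv j ((q + q') z) t
      = iteratedDeriv j (q z) t + iteratedDeriv j (q' z) t := fun j hj z hz t => by
    have hj' : (j : WithTop ℕ∞) ≤ J := by exact_mod_cast hj
    exact iteratedDeriv_add ((h.contDiff z hz).of_le hj').contDiffAt
      ((h'.contDiff z hz).of_le hj').contDiffAt
  refine ⟨fun z hz => (h.periodic z hz).add (h'.periodic z hz),
    fun z hz => (h.contDiff z hz).add (h'.contDiff z hz), fun j hj => ?_,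
    h.continuousOn_noise.add h'.continuousOn_noise, fun z hz t => ?_⟩
  · exact ((h.continuousOn_deriv j hj).add (h'.continuousOn_deriv j hj)).congr
      fun w hw => key j hj w.1 hw.1 w.2
  · convert! (h.evolution z hz t).add (h'.evolution z hz t) using 1
    rw [Finset.sum_congr rfl fun j hj => by
      rw [key j (Nat.lt_succ_iff.1 (Finset.mem_range.1 hj)) z hz t, mul_add],
      Finset.sum_add_distrib, Pi.add_apply, Pi.add_apply]
    ring

theorem IsTrajectory.smul {T L : ℝ} {J : ℕ} {a : ℕ → ℂ} {n q : ℝ → ℝ → ℂ} (c : ℂ)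
    (h : IsTrajectory T L J a n q) : IsTrajectory T L J a (c • n) (c • q) := by
  have key : ∀ j ≤ J, ∀ z ∈ Icc 0 L, ∀ t, iteratedDeriv j ((c • q) z) t
      = c * iteratedDeriv j (q z) t := fun j hj z hz t => by
    have hj' : (j : WithTop ℕ∞) ≤ J := by exact_mod_cast hj
    exact iteratedDeriv_const_smul ((h.contDiff z hz).of_le hj').contDiffAt c
  refine ⟨fun z hz t => congrArg (c * ·) (h.periodic z hz t),
    fun z hz => (h.contDiff z hz).const_smul c, fun j hj => ?_,
    continuousOn_const.mul h.continuousOn_noise, fun z hz t => ?_⟩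
  · exact (continuousOn_const.mul (h.continuousOn_deriv j hj)).congr
      fun w hw => key j hj w.1 hw.1 w.2
  · convert! (h.evolution z hz t).const_mul c using 1
    rw [Finset.sum_congr rfl fun j hj => by
      rw [key j (Nat.lt_succ_iff.1 (Finset.mem_range.1 hj)) z hz t, mul_left_comm],
      ← Finset.mul_sum, Pi.smul_apply, Pi.smul_apply, smul_eq_mul]
    ring

theorem IsTrajectory.zero (T L : ℝ) (J : ℕ) (a : ℕ → ℂ) : IsTrajectory T L J a 0 0 := by
  have key : ∀ (j : ℕ) (z t : ℝ), iteratedDeriv j ((0 : ℝ → ℝ → ℂ) z) t = 0 := fun j z t => by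
    simp
  refine ⟨fun _ _ _ => rfl, fun _ _ => contDiff_const, fun j _ => ?_, continuousOn_const,
    fun z _ t => ?_⟩
  · simp only [key]
    exact continuousOn_const
  · simp only [key]
    simpa using hasDerivWithinAt_const z (Icc 0 L) (0 : ℂ)

/-- The profile `φ` is free because the control is simply read off from the equation. All test
variations are built from these. -/
theorem isTrajectory_mode {T : ℝ} (hT : 0 < T) (L : ℝ) (J : ℕ) (a : ℕ → ℂ) (m : ℤ)
    {φ φ' : ℝ → ℂ} (hφ : ∀ z, HasDerivAt φ (φ' z) z) (hφ' : Continuous φ') :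
    IsTrajectory T L J a (fun z t => (φ' z - symbol T J a m * φ z) * expMode T m t)
      (fun z t => φ z * expMode T m t) := by
  have hφc : Continuous φ := continuous_iff_continuousAt.2 fun z => (hφ z).continuousAt
  have he := continuous_expMode T m
  have key : ∀ (j : ℕ) (z t : ℝ), iteratedDeriv j (fun t => φ z * expMode T m t) t
      = (Complex.I * ((m * Real.pi / T : ℝ) : ℂ)) ^ j * (φ z * expMode T m t) := fun j z t => by
    rw [iteratedDeriv_const_mul _ (contDiff_expMode T m).contDiffAt, iteratedDeriv_expMode]
    ring
  refine ⟨fun z _ t => congrArg (φ z * ·) (expMode_periodic hT m t),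
    fun z _ => contDiff_const.mul (contDiff_expMode T m), fun j _ => ?_, ?_, fun z _ t => ?_⟩
  · simp only [key]
    fun_prop
  · fun_prop
  · simp only [key]
    convert! ((hφ z).mul_const (expMode T m t)).hasDerivWithinAt using 1
    rw [symbol_eq_sum]
    simp only [← mul_assoc, ← Finset.sum_mul]
    ring

/-! ### The differential equation of the Fourier coefficients. -/

theorem periodic_iteratedDeriv {f : ℝ → ℂ} {c : ℝ} (hf : Function.Periodic f c) (j : ℕ) :
    Function.Periodic (iteratedDeriv j f) c := fun t => by
  have h := congrFun (iteratedDeriv_comp_add_const j f c) t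
  rw [← h, show (fun z => f (z + c)) = f from funext hf]

/-- Repeated integration by parts; the boundary terms cancel by periodicity. -/
theorem integral_expMode_iteratedDeriv {T : ℝ} (hT : 0 < T) {J : ℕ} {f : ℝ → ℂ}
    (hf : ContDiff ℝ J f) (hp : Function.Periodic f (2 * T)) (m : ℤ) {j : ℕ} (hj : j ≤ J) :
    ∫ t in (-T)..T, conj (expMode T m t) * iteratedDeriv j f t
      = (Complex.I * ((m * Real.pi / T : ℝ) : ℂ)) ^ j
        * ∫ t in (-T)..T, conj (expMode T m t) * f t := by
  induction j with
  | zero => simp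
  | succ j ih =>
    have hj' : (j : WithTop ℕ∞) < J := by exact_mod_cast hj
    have hd : ∀ t, HasDerivAt (iteratedDeriv j f) (iteratedDeriv (j + 1) f t) t := fun t => by
      rw [iteratedDeriv_succ]
      exact (hf.differentiable_iteratedDeriv j hj' t).hasDerivAt
    have he := continuous_expMode T (-m)
    have hend : ∀ g : ℝ → ℂ, Function.Periodic g (2 * T) → g (-T) = g T := fun g hg => by
      rw [← hg (-T)]
      congr 1
      ring
    simp only [conj_expMode] at ih ⊢
    rw [intervalIntegral.integral_mul_deriv_eq_deriv_mul
      (fun t _ => hasDerivAt_expMode T (-m) t) (fun t _ => hd t)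
      ((continuous_const.mul he).intervalIntegrable _ _)
      ((hf.continuous_iteratedDeriv (j + 1) (by exact_mod_cast hj)).intervalIntegrable _ _),
      hend _ (expMode_periodic hT (-m)), hend _ (periodic_iteratedDeriv hp j)]
    simp only [mul_assoc, intervalIntegral.integral_const_mul] at ih ⊢
    rw [ih (by omega)]
    push_cast
    ring

/-- Integrating the evolution in `z` and exchanging the integrals writes the coefficient as a
primitive of a continuous function, which avoids differentiating under the integral sign. -/
theorem IsTrajectory.hasDerivWithinAt_fourierCoeffOn {T L : ℝ} (hT : 0 < T) (hL : 0 < L)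
    {J : ℕ} {a : ℕ → ℂ} {n q : ℝ → ℝ → ℂ} (h : IsTrajectory T L J a n q) (m : ℤ) {z : ℝ}
    (hz : z ∈ Icc 0 L) :
    HasDerivWithinAt (fun s => fourierCoeffOn (neg_lt_self hT) (q s) m)
      (symbol T J a m * fourierCoeffOn (neg_lt_self hT) (q z) m
        + fourierCoeffOn (neg_lt_self hT) (n z) m) (Icc 0 L) z := by
  set g : ℝ → ℝ → ℂ := fun s t =>
    ∑ j ∈ Finset.range (J + 1), a j * iteratedDeriv j (q s) t + n s t with hg
  have hle : ∀ {j}, j ∈ Finset.range (J + 1) → j ≤ J := fun hj =>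
    Nat.lt_succ_iff.1 (Finset.mem_range.1 hj)
  have he := continuous_expMode T m
  have hgc : ContinuousOn (fun w : ℝ × ℝ => g w.1 w.2) (Icc 0 L ×ˢ univ) :=
    (continuousOn_finsetSum _ fun j hj =>
      continuousOn_const.mul (h.continuousOn_deriv j (hle hj))).add h.continuousOn_noise
  have hG : ∀ s ∈ Icc 0 L, fourierCoeffOn (neg_lt_self hT) (g s) m
      = symbol T J a m * fourierCoeffOn (neg_lt_self hT) (q s) m
        + fourierCoeffOn (neg_lt_self hT) (n s) m := fun s hs => by
    have hce : Continuous fun t => conj (expMode T m t) := Complex.continuous_conj.comp he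
    have hi : ∀ j ∈ Finset.range (J + 1), IntervalIntegrable
        (fun t => a j * (conj (expMode T m t) * iteratedDeriv j (q s) t)) volume (-T) T :=
      fun j hj => (continuous_const.mul
        (hce.mul (slice_continuous (f := fun s t => iteratedDeriv j (q s) t)
          (h.continuousOn_deriv j (hle hj)) hs))).intervalIntegrable _ _
    simp only [fourierCoeffOn_eq_expMode hT, hg, mul_add, Finset.mul_sum,
      mul_left_comm (conj _) (a _)]
    rw [intervalIntegral.integral_add, intervalIntegral.integral_finsetSum hi, symbol_eq_sum]
    · simp only [intervalIntegral.integral_const_mul]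
      rw [Finset.sum_congr rfl fun j hj => by
        rw [integral_expMode_iteratedDeriv hT (h.contDiff s hs) (h.periodic s hs) m (hle hj),
          ← mul_assoc], ← Finset.sum_mul]
      ring
    · exact (continuous_finsetSum _ fun j hj => continuous_const.mul
        (hce.mul (slice_continuous (f := fun s t => iteratedDeriv j (q s) t)
          (h.continuousOn_deriv j (hle hj)) hs))).intervalIntegrable _ _
    · exact (hce.mul (slice_continuous h.continuousOn_noise hs)).intervalIntegrable _ _
  have hGc := continuousOn_fourierCoeffOn hT hL.le hgc m
  have hq0 : ∀ s ∈ Icc 0 L, Continuous (q s) := fun s hs => (h.contDiff s hs).continuous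
  have hint : ∀ s ∈ Icc 0 L, fourierCoeffOn (neg_lt_self hT) (q s) m
      = fourierCoeffOn (neg_lt_self hT) (q 0) m
        + ∫ r in (0 : ℝ)..s, fourierCoeffOn (neg_lt_self hT) (g r) m := fun s hs => by
    have hsub : Icc 0 s ⊆ Icc 0 L := Icc_subset_Icc_right hs.2
    have hce : Continuous fun t => conj (expMode T m t) := Complex.continuous_conj.comp he
    have ftc : ∀ t, ∫ r in (0 : ℝ)..s, g r t = q s t - q 0 t := fun t => by
      refine intervalIntegral.integral_eq_sub_of_hasDerivAt_of_le hs.1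
        (fun r hr => ((h.evolution r (hsub hr) t).continuousWithinAt).mono hsub) (fun r hr => ?_)
        (intervalIntegrable_of_continuousOn_Icc hs.1 ?_)
      · exact (h.evolution r (hsub (Ioo_subset_Icc_self hr)) t).hasDerivAt
          (Icc_mem_nhds hr.1 (hr.2.trans_le hs.2))
      · exact hgc.comp (f := fun r : ℝ => (r, t)) (by fun_prop)
          fun r hr => ⟨hsub hr, mem_univ _⟩
    have hswap := intervalIntegral_intervalIntegral_swap (a := 0) (b := s) (c := -T) (d := T)
      (F := fun r t => conj (expMode T m t) * g r t) (by
        rw [uIoc_of_le hs.1, uIoc_of_le (by linarith)]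
        refine IntegrableOn.mono_set (ContinuousOn.integrableOn_compact
          (K := Icc 0 s ×ˢ Icc (-T) T) (isCompact_Icc.prod isCompact_Icc) ?_)
          (prod_mono Ioc_subset_Icc_self Ioc_subset_Icc_self)
        exact (continuousOn_conj_mul (f := fun _ t => expMode T m t)
          (he.comp continuous_snd).continuousOn hgc).mono (prod_mono hsub (subset_univ _)))
    simp only [fourierCoeffOn_eq_expMode hT, intervalIntegral.integral_const_mul, hswap, ftc,
      mul_sub]
    have hi : ∀ r ∈ Icc 0 L, IntervalIntegrable (fun t => conj (expMode T m t) * q r t)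
        volume (-T) T := fun r hr => (hce.mul (hq0 r hr)).intervalIntegrable _ _
    rw [intervalIntegral.integral_sub (hi s hs) (hi 0 ⟨le_rfl, hL.le⟩)]
    ring
  have hext : Continuous (fun r =>
      fourierCoeffOn (neg_lt_self hT) (g (projIcc 0 L hL.le r)) m) :=
    hGc.comp_continuous (continuous_subtype_val.comp continuous_projIcc) fun r =>
      (projIcc 0 L hL.le r).2
  have hder := (hext.integral_hasStrictDerivAt 0 z).hasDerivAt.const_add
    (fourierCoeffOn (neg_lt_self hT) (q 0) m)
  rw [projIcc_of_mem hL.le hz, hG z hz] at hder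
  refine hder.hasDerivWithinAt.congr_of_mem (fun s hs => ?_) hz
  rw [hint s hs]
  congr 1
  refine intervalIntegral.integral_congr fun r hr => ?_
  rw [uIcc_of_le hs.1] at hr
  simp only [projIcc_of_mem hL.le ⟨hr.1, hr.2.trans hs.2⟩]

/-! ### Stationary controls -/

/-- The derivative of `f ^ (k + 1) * h` is `f ^ k` times a smooth function; the induction therefore
has to allow every smooth `h`. -/
theorem iteratedDeriv_pow_mul_eq_zero {f : ℝ → ℂ} (hf : ContDiff ℝ (⊤ : ℕ∞) f) {t : ℝ}
    (h0 : f t = 0) (j : ℕ) : ∀ (k : ℕ) (h : ℝ → ℂ), ContDiff ℝ (⊤ : ℕ∞) h → j < k →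
      iteratedDeriv j (fun s => f s ^ k * h s) t = 0 := by
  induction j with
  | zero =>
    intro k h _ hk
    simp [h0, hk.ne']
  | succ j ih =>
    intro k h hh hk
    obtain ⟨k, rfl⟩ : ∃ l, k = l + 1 := ⟨k - 1, by omega⟩
    have hd : deriv (fun s => f s ^ (k + 1) * h s)
        = fun s => f s ^ k * ((k + 1 : ℕ) * deriv f s * h s + f s * deriv h s) := by
      funext s
      have hf' := (hf.differentiable (by simp) s).hasDerivAt
      have hh' := (hh.differentiable (by simp) s).hasDerivAt
      rw [((hf'.fun_pow (k + 1)).fun_mul hh').deriv]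
      simp
      ring
    rw [iteratedDeriv_succ', hd]
    refine ih k _ ?_ (by omega)
    have hdf : ContDiff ℝ (⊤ : ℕ∞) (deriv f) := (contDiff_infty_iff_deriv.1 hf).2
    have hdh : ContDiff ℝ (⊤ : ℕ∞) (deriv h) := (contDiff_infty_iff_deriv.1 hh).2
    exact ((contDiff_const.mul hdf).mul hh).add (hf.mul hdh)

/-- A single mode does not vanish at `± T`. Since `expMode T 1` equals `-1` there, the factor
supplies a zero of order `J + 1`. -/
theorem mem_alphabet_of_expMode {T : ℝ} (hT : 0 < T) (J : ℕ) (m : ℤ) :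
    (fun t => (1 + expMode T 1 t) ^ (J + 1) * expMode T m t) ∈ alphabet T J := by
  have hs : ContDiff ℝ (⊤ : ℕ∞) (fun t => 1 + expMode T 1 t) :=
    contDiff_const.add (contDiff_expMode T 1)
  have hc : ContDiff ℝ (⊤ : ℕ∞) (fun t => (1 + expMode T 1 t) ^ (J + 1) * expMode T m t) :=
    (hs.pow _).mul (contDiff_expMode T m)
  refine ⟨fun t => ?_, hc.of_le (by exact_mod_cast le_top), ?_, fun j hj => ?_⟩
  · simp only [expMode_periodic hT 1 t, expMode_periodic hT m t]
  · obtain ⟨K, hK⟩ := (hc.of_le (m := 1)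
      (by exact_mod_cast le_top)).locallyLipschitz.locallyLipschitzOn
      |>.exists_lipschitzOnWith_of_compact (isCompact_Icc (a := -T) (b := T))
    exact hK.comp_boundedVariationOn (mapsTo_id _)
      (monotone_id.monotoneOn _ |>.boundedVariationOn (C := T) fun x hx => abs_le.2 hx)
  · exact iteratedDeriv_pow_mul_eq_zero hs (by simp [expMode_one_end hT]) j (J + 1) _
      (contDiff_expMode T m) (by omega)

/-- **du Bois-Reymond lemma** -/
theorem eq_of_integral_mul_deriv_eq_zero {L : ℝ} (hL : 0 < L) {F : ℝ → ℂ}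
    (hF : ContinuousOn F (Icc 0 L))
    (h : ∀ η η' : ℝ → ℂ, (∀ z, HasDerivAt η (η' z) z) → Continuous η' → η 0 = 0 → η L = 0 →
      ∫ z in (0 : ℝ)..L, F z * η' z = 0) : ∀ z ∈ Icc 0 L, F z = F 0 := by
  set G : ℝ → ℂ := fun z => F (projIcc 0 L hL.le z) with hG
  have hGc : Continuous G := hF.comp_continuous
    (continuous_subtype_val.comp continuous_projIcc) fun r => (projIcc 0 L hL.le r).2
  have hGF : ∀ z ∈ Icc 0 L, G z = F z := fun z hz => by simp only [hG, projIcc_of_mem hL.le hz]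
  set c : ℂ := (∫ z in (0 : ℝ)..L, G z) / L with hc
  have hLc : (L : ℂ) ≠ 0 := by exact_mod_cast hL.ne'
  set H : ℝ → ℂ := fun z => G z - c with hH
  have hHc : Continuous H := hGc.sub continuous_const
  have hH0 : ∫ z in (0 : ℝ)..L, H z = 0 := by
    rw [intervalIntegral.integral_sub (hGc.intervalIntegrable _ _)
      (continuous_const.intervalIntegrable _ _), intervalIntegral.integral_const, hc]
    simp
    field_simp
    simp
  have hcc : Continuous fun z => conj (H z) := Complex.continuous_conj.comp hHc
  have hcH0 : ∫ z in (0 : ℝ)..L, conj (H z) = 0 := by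
    rw [intervalIntegral.intervalIntegral_conj, hH0, map_zero]
  -- The test function has derivative `conj (F - c)`, with `c` the mean of `F`; mean zero makes it
  -- vanish at `L`.
  have h1 := h (fun z => ∫ r in (0 : ℝ)..z, conj (H r)) (fun z => conj (H z))
    (fun z => (hcc.integral_hasStrictDerivAt 0 z).hasDerivAt) hcc
    intervalIntegral.integral_same hcH0
  have h2 : ∫ z in (0 : ℝ)..L, ((‖H z‖ ^ 2 : ℝ) : ℂ) = 0 := by
    have h3 : ∫ z in (0 : ℝ)..L, F z * conj (H z)
        = ∫ z in (0 : ℝ)..L, (((‖H z‖ ^ 2 : ℝ) : ℂ) + c * conj (H z)) := by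
      refine intervalIntegral.integral_congr fun z hz => ?_
      rw [uIcc_of_le hL.le] at hz
      rw [Complex.ofReal_pow, ← Complex.mul_conj', ← add_mul, ← hGF z hz]
      simp [hH]
    have hi : IntervalIntegrable (fun z => ((‖H z‖ ^ 2 : ℝ) : ℂ)) volume 0 L :=
      (Complex.continuous_ofReal.comp (hHc.norm.pow 2)).intervalIntegrable _ _
    have hi' : IntervalIntegrable (fun z => c * conj (H z)) volume 0 L :=
      (continuous_const.mul hcc).intervalIntegrable _ _
    rw [h3, intervalIntegral.integral_add hi hi', intervalIntegral.integral_const_mul,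
      hcH0, mul_zero, add_zero] at h1
    exact h1
  rw [intervalIntegral.integral_ofReal] at h2
  have h4 : ∀ z ∈ Icc 0 L, H z = 0 := by
    have h2' : ∫ z in (0 : ℝ)..L, ‖H z‖ ^ 2 = 0 := by exact_mod_cast h2
    intro z hz
    by_contra hne
    have hpos := intervalIntegral.integral_pos hL (f := fun z => ‖H z‖ ^ 2)
      (hHc.norm.pow 2).continuousOn (fun _ _ => by positivity) ⟨z, hz, by positivity⟩
    exact hpos.ne' h2'
  intro z hz
  have hz0 := h4 z hz
  have h00 := h4 0 ⟨le_rfl, hL.le⟩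
  simp only [hH, sub_eq_zero] at hz0 h00
  rw [← hGF z hz, ← hGF 0 ⟨le_rfl, hL.le⟩, hz0, h00]

theorem eq_zero_of_forall_re_eq_zero {w : ℂ} (h : ∀ c : ℂ, (c * w).re = 0) : w = 0 := by
  have h1 := h (conj w)
  rw [mul_comm, Complex.mul_conj, Complex.ofReal_re] at h1
  exact Complex.normSq_eq_zero.1 h1

/-- Euler-Lagrange equation for the Fourier coefficients of a control that is stationary with
respect to the variations of the trajectory with fixed ends. -/
theorem fourierCoeffOn_of_stationary {T L : ℝ} (hT : 0 < T) (hL : 0 < L) {J : ℕ} {a : ℕ → ℂ}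
    {f : ℝ → ℝ → ℂ} (hf : ContinuousOn (fun w : ℝ × ℝ => f w.1 w.2) (Icc 0 L ×ˢ univ))
    (h : ∀ ν δ, IsTrajectory T L J a ν δ → δ 0 = 0 → δ L = 0 → (pairing T L f ν).re = 0)
    (m : ℤ) {z : ℝ} (hz : z ∈ Icc 0 L) :
    fourierCoeffOn (neg_lt_self hT) (f z) m
      = fourierCoeffOn (neg_lt_self hT) (f 0) m
        * Complex.exp (-(conj (symbol T J a m)) * z) := by
  set r := symbol T J a m
  have hexp : ∀ z : ℝ, HasDerivAt (fun z : ℝ => Complex.exp (r * z)) (r * Complex.exp (r * z)) z :=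
    fun z => by
      have h := ((Complex.ofRealCLM.hasDerivAt (x := z)).const_mul r).cexp
      simpa [mul_comm] using h
  have hec : Continuous fun z : ℝ => Complex.exp (r * z) := by fun_prop
  have key := eq_of_integral_mul_deriv_eq_zero hL
    (F := fun z => conj (fourierCoeffOn (neg_lt_self hT) (f z) m) * Complex.exp (r * z))
    ((Complex.continuous_conj.comp_continuousOn (continuousOn_fourierCoeffOn hT hL.le hf m)).mul
      hec.continuousOn) (fun η η' hη hη' h0 hL0 => ?_) z hz
  · have h2 := congrArg conj key
    simp only [map_mul, Complex.conj_conj, ← Complex.exp_conj, Complex.conj_ofReal] at h2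
    rw [neg_mul, Complex.exp_neg]
    rw [eq_mul_inv_iff_mul_eq₀ (Complex.exp_ne_zero _), h2]
    simp
  · refine eq_zero_of_forall_re_eq_zero fun c => ?_
    have hηc : Continuous η := continuous_iff_continuousAt.2 fun z => (hη z).continuousAt
    -- The factor `e^{r z}` cancels the drift: the control of this variation has coefficient `c /
    -- (2T) * η' e^{r z}`.
    have htr := isTrajectory_mode hT L J a m (φ := fun z => c / (2 * T) * (η z * Complex.exp (r * z)))
      (fun z => ((hη z).mul (hexp z)).const_mul _) (by fun_prop)
    have hz1 := h _ _ htr (by funext t; simp [h0]) (by funext t; simp [hL0])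
    rw [pairing_mode hT] at hz1
    refine Eq.trans (congrArg Complex.re ?_) hz1
    rw [← intervalIntegral.integral_const_mul, ← intervalIntegral.integral_const_mul]
    congr 1
    funext z
    have hT' : (T : ℂ) ≠ 0 := by exact_mod_cast hT.ne'
    field_simp
    ring

/-! ### The end condition at `z = L`. -/

/-- If `b (m + 1) = -b m` for all `m`, then `b` has constant modulus, so it cannot tend to 0 unless
it is zero. Each induction step removes one factor of the iterate. -/
theorem eq_zero_of_iterate_add_shift_eq_zero (k : ℕ) : ∀ b : ℤ → ℂ,
    Filter.Tendsto b Filter.atTop (nhds 0) → (fun b : ℤ → ℂ => fun m => b m + b (m + 1))^[k] b = 0 →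
      b = 0 := by
  induction k with
  | zero => exact fun b _ h => h
  | succ k ih =>
    intro b hb h
    have hshift : Filter.Tendsto (fun m : ℤ => b (m + 1)) Filter.atTop (nhds 0) :=
      hb.comp (Filter.tendsto_atTop_add_const_right _ 1 Filter.tendsto_id)
    have h0 := ih (fun m => b m + b (m + 1)) (by simpa using hb.add hshift) h
    have hn : ∀ m, ‖b (m + 1)‖ = ‖b m‖ := fun m => by
      rw [eq_neg_of_add_eq_zero_right (congrFun h0 m), norm_neg]
    have hk : ∀ (m : ℤ) (k : ℕ), ‖b (m + k)‖ = ‖b m‖ := fun m k => by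
      induction k with
      | zero => simp
      | succ k ihk => rw [← ihk, ← hn (m + k), add_assoc]; push_cast; rfl
    funext m
    have ht : Filter.Tendsto (fun k : ℕ => ‖b (m + k)‖) Filter.atTop (nhds 0) := by
      have := hb.comp (Filter.tendsto_atTop_add_const_left _ m
        (tendsto_natCast_atTop_atTop (R := ℤ)))
      simpa using this.norm
    simp only [hk] at ht
    exact norm_eq_zero.1 (tendsto_nhds_unique tendsto_const_nhds ht)

theorem tendsto_fourierCoeffOn_zero {T : ℝ} (hT : 0 < T) {f : ℝ → ℂ} (hf : Continuous f) :
    Filter.Tendsto (fun m => fourierCoeffOn (neg_lt_self hT) f m) Filter.atTop (nhds 0) := by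
  have h := (hasSum_sq_fourierCoeffOn_continuous hT hf).summable.tendsto_cofinite_zero
  have h2 : Filter.Tendsto (fun m => ‖fourierCoeffOn (neg_lt_self hT) f m‖)
      Filter.cofinite (nhds 0) := by
    simpa using h.sqrt
  refine tendsto_zero_iff_norm_tendsto_zero.2 (h2.mono_left ?_)
  rw [Int.cofinite_eq]
  exact le_sup_right

/-- The Fourier coefficients vanish for a control that is stationary with respect to all variations
of the trajectory with fixed start and with an end that varies in the alphabet. -/
theorem fourierCoeffOn_eq_zero_of_stationary {T L : ℝ} (hT : 0 < T) (hL : 0 < L) {J : ℕ}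
    {a : ℕ → ℂ} {f : ℝ → ℝ → ℂ}
    (hf : ContinuousOn (fun w : ℝ × ℝ => f w.1 w.2) (Icc 0 L ×ˢ univ))
    (h : ∀ ν δ, IsTrajectory T L J a ν δ → δ 0 = 0 → δ L ∈ alphabet T J →
      (pairing T L f ν).re = 0) (m : ℤ) {z : ℝ} (hz : z ∈ Icc 0 L) :
    fourierCoeffOn (neg_lt_self hT) (f z) m = 0 := by
  have hEL : ∀ (m : ℤ), ∀ z ∈ Icc 0 L, fourierCoeffOn (neg_lt_self hT) (f z) m
      = fourierCoeffOn (neg_lt_self hT) (f 0) m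
        * Complex.exp (-(conj (symbol T J a m)) * z) := fun m z hz =>
    fourierCoeffOn_of_stationary hT hL hf
      (fun ν δ hνδ h0 h1 => h ν δ hνδ h0 (h1 ▸ Submodule.zero_mem _)) m hz
  have hLmem : L ∈ Icc 0 L := ⟨hL.le, le_rfl⟩
  have hT' : (T : ℂ) ≠ 0 := by exact_mod_cast hT.ne'
  have hL' : (L : ℂ) ≠ 0 := by exact_mod_cast hL.ne'
  set b : ℤ → ℂ := fun m => conj (fourierCoeffOn (neg_lt_self hT) (f L) m) with hb
  -- Multiplying the end by `1 + expMode T 1` adds the variations for `m` and `m + 1`, so the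
  -- pairing undergoes `b m + b (m + 1)`.
  have hstep : ∀ (k : ℕ) (m : ℤ), ∃ ν δ, IsTrajectory T L J a ν δ ∧ δ 0 = 0 ∧
      δ L = (fun t => (1 + expMode T 1 t) ^ k * expMode T m t) ∧
      pairing T L f ν = 2 * T * (fun b : ℤ → ℂ => fun m => b m + b (m + 1))^[k] b m := by
    intro k
    induction k with
    | zero =>
      intro m
      set r := symbol T J a m with hr
      have htr := isTrajectory_mode hT L J a m (φ := fun z : ℝ => (z / L : ℂ))
        (φ' := fun _ => (1 / L : ℂ))
        (fun z => (Complex.ofRealCLM.hasDerivAt (x := z)).div_const _) continuous_const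
      refine ⟨_, _, htr, by funext t; simp, by funext t; simp [hL'], ?_⟩
      rw [pairing_mode hT, Function.iterate_zero_apply]
      congr 1
      set β := conj (fourierCoeffOn (neg_lt_self hT) (f 0) m) with hβ
      have hconj : ∀ z ∈ Icc 0 L, conj (fourierCoeffOn (neg_lt_self hT) (f z) m)
          = β * Complex.exp (-(r * z)) := fun z hz => by
        rw [hEL m z hz, map_mul, ← Complex.exp_conj]
        simp [hβ, hr]
      -- By the Euler-Lagrange equation the integrand of the pairing is an exact derivative, and
      -- only the value at `L` survives.
      have hd : ∀ z : ℝ, HasDerivAt (fun z : ℝ => β * Complex.exp (-(r * z)) * (z / L))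
          (β * Complex.exp (-(r * z)) * (1 / L - r * (z / L))) z := fun z => by
        have h1 := (((Complex.ofRealCLM.hasDerivAt (x := z)).const_mul r).neg.cexp.const_mul β).mul
          ((Complex.ofRealCLM.hasDerivAt (x := z)).div_const (L : ℂ))
        refine h1.congr_deriv ?_
        simp
        ring
      have hint := intervalIntegral.integral_eq_sub_of_hasDerivAt (a := 0) (b := L)
        (fun z _ => hd z) (Continuous.intervalIntegrable (by fun_prop) _ _)
      simp only [hb, hconj L hLmem]
      rw [Complex.ofReal_zero, zero_div, mul_zero, sub_zero, div_self hL', mul_one] at hint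
      rw [← hint]
      refine intervalIntegral.integral_congr fun z hz => ?_
      rw [uIcc_of_le hL.le] at hz
      simp only [hconj z hz, hr]
    | succ k ih =>
      intro m
      obtain ⟨ν₁, δ₁, ht₁, h0₁, hL₁, hp₁⟩ := ih m
      obtain ⟨ν₂, δ₂, ht₂, h0₂, hL₂, hp₂⟩ := ih (m + 1)
      refine ⟨_, _, ht₁.add ht₂, by simp [h0₁, h0₂], ?_, ?_⟩
      · rw [Pi.add_apply, hL₁, hL₂]
        funext t
        rw [Pi.add_apply, ← expMode_mul]
        ring
      · rw [pairing_add_right hL.le hf ht₁.continuousOn_noise ht₂.continuousOn_noise, hp₁, hp₂,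
          Function.iterate_succ_apply']
        ring
  have hz0 : (fun b : ℤ → ℂ => fun m => b m + b (m + 1))^[J + 1] b = 0 := by
    funext m
    refine eq_zero_of_forall_re_eq_zero fun c => ?_
    obtain ⟨ν, δ, ht, h0, hδL, hp⟩ := hstep (J + 1) m
    have := h _ _ (ht.smul (c / (2 * T))) (by simp [h0]) (by
      rw [Pi.smul_apply, hδL]
      exact Submodule.smul_mem _ _ (mem_alphabet_of_expMode hT J m))
    rw [pairing_smul_right, hp] at this
    rw [← this]
    congr 1
    field_simp
  have hbt : Filter.Tendsto b Filter.atTop (nhds 0) := by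
    have := (Complex.continuous_conj.tendsto 0).comp
      (tendsto_fourierCoeffOn_zero hT (slice_continuous hf hLmem))
    simpa [Function.comp_def, hb] using this
  have hb0 := congrFun (eq_zero_of_iterate_add_shift_eq_zero (J + 1) b hbt hz0) m
  have h1 : fourierCoeffOn (neg_lt_self hT) (f L) m = 0 := by simpa [hb] using hb0
  rw [hEL m L hLmem, mul_eq_zero, or_iff_left (Complex.exp_ne_zero _)] at h1
  rw [hEL m z hz, h1, zero_mul]

/-! ### First order conditions for a minimizing pair -/

/-- Karush-Kuhn-Tucker conditions for two linear functionals: `E₁` and `E₂` are the values at a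
minimizer of the maximum, `d` is the minimal value. -/
theorem exists_multipliers {V : Type*} [AddCommGroup V] [Module ℝ V] (l₁ l₂ : V →ₗ[ℝ] ℝ)
    {d E₁ E₂ : ℝ} (h₁ : E₁ ≤ d) (h₂ : E₂ ≤ d)
    (h : ∀ v, ¬ ((E₁ < d ∨ l₁ v < 0) ∧ (E₂ < d ∨ l₂ v < 0))) :
    ∃ μ₁ μ₂ : ℝ, 0 ≤ μ₁ ∧ 0 ≤ μ₂ ∧ μ₁ + μ₂ = 1 ∧ μ₁ * (d - E₁) = 0 ∧ μ₂ * (d - E₂) = 0 ∧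
      ∀ v, μ₁ * l₁ v + μ₂ * l₂ v = 0 := by
  have hz : ∀ l : V →ₗ[ℝ] ℝ, (∀ v, ¬ l v < 0) → ∀ v, l v = 0 := fun l hl v => by
    have h1 := hl v
    have h2 := hl (-v)
    rw [map_neg] at h2
    linarith
  rcases h₁.lt_or_eq with h1 | h1
  -- If both constraints were slack, `v = 0` would violate the hypothesis.
  · have h2 := h₂.lt_or_eq.resolve_left fun h2 => h 0 ⟨Or.inl h1, Or.inl h2⟩
    have := hz l₂ fun v hv => h v ⟨Or.inl h1, Or.inr hv⟩
    exact ⟨0, 1, le_rfl, zero_le_one, by simp, by simp, by simp [h2], fun v => by simp [this v]⟩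
  rcases h₂.lt_or_eq with h2 | h2
  · have := hz l₁ fun v hv => h v ⟨Or.inr hv, Or.inl h2⟩
    exact ⟨1, 0, zero_le_one, le_rfl, by simp, by simp [h1], by simp, fun v => by simp [this v]⟩
  by_cases hl : ∀ v, l₁ v = 0
  · exact ⟨1, 0, zero_le_one, le_rfl, by simp, by simp [h1], by simp, fun v => by simp [hl v]⟩
  push Not at hl
  obtain ⟨u, hu⟩ := hl
  obtain ⟨w, hw⟩ : ∃ w, l₁ w = -1 := ⟨(-(l₁ u)⁻¹) • u, by simp [hu]⟩
  have hw2 : 0 ≤ l₂ w := by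
    by_contra hneg
    exact h w ⟨Or.inr (by linarith), Or.inr (not_le.1 hneg)⟩
  have hker : ∀ v, l₂ v + l₂ w * l₁ v = 0 := fun v => by
    by_contra hne
    set k := v + l₁ v • w with hk
    have hk1 : l₁ k = 0 := by simp [hk, hw]
    have hk2 : l₂ k ≠ 0 := by
      simp only [hk, map_add, map_smul, smul_eq_mul]
      rwa [mul_comm]
    -- Adding a multiple of `k ∈ ker l₁` keeps `l₁ = -1`; this multiple makes `l₂ = -1` too.
    refine h (w + (-(l₂ w + 1) * (l₂ k)⁻¹) • k) ⟨Or.inr ?_, Or.inr ?_⟩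
    · simp [hk1, hw]
    · simp only [map_add, map_smul, smul_eq_mul, mul_assoc, inv_mul_cancel₀ hk2]
      linarith
  have hpos : 0 < 1 + l₂ w := by linarith
  refine ⟨l₂ w / (1 + l₂ w), 1 / (1 + l₂ w), by positivity, by positivity,
    by field_simp; ring, by simp [h1], by simp [h2], fun v => ?_⟩
  have := hker v
  field_simp
  linarith

/-- A slack constraint survives small perturbations by continuity; an active one improves when the
linear term is negative, since it dominates the quadratic term. -/
theorem eventually_effort_lt {T L : ℝ} (hL : 0 ≤ L) {f g : ℝ → ℝ → ℂ} {d : ℝ}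
    (hf : ContinuousOn (fun w : ℝ × ℝ => f w.1 w.2) (Icc 0 L ×ˢ univ))
    (hg : ContinuousOn (fun w : ℝ × ℝ => g w.1 w.2) (Icc 0 L ×ˢ univ))
    (hd : effort T L f ≤ d) (h : effort T L f < d ∨ (pairing T L f g).re < 0) :
    ∀ᶠ ε : ℝ in nhdsWithin 0 (Ioi 0), effort T L (f + (ε : ℂ) • g) < d := by
  simp only [effort_add_smul hL hf hg]
  rcases h with h | h
  · have hc : Continuous fun ε : ℝ =>
        effort T L f + ε * (2 * (pairing T L f g).re + ε * effort T L g) := by fun_prop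
    exact nhdsWithin_le_nhds ((hc.tendsto 0).eventually (gt_mem_nhds (by simpa using h)))
  · have hc : Continuous fun ε : ℝ => 2 * (pairing T L f g).re + ε * effort T L g := by fun_prop
    have h1 : ∀ᶠ ε : ℝ in nhdsWithin 0 (Ioi 0),
        2 * (pairing T L f g).re + ε * effort T L g < 0 :=
      nhdsWithin_le_nhds ((hc.tendsto 0).eventually (gt_mem_nhds (by linarith)))
    filter_upwards [h1, self_mem_nhdsWithin] with ε h1 hε
    have := mul_neg_of_pos_of_neg hε h1
    linarith

/-- Pairs of variations `((ν₁, δ₁), (ν₂, δ₂))` of two trajectories that keep the starts fixed, and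
keep the ends equal and in the alphabet. -/
def variations (T L : ℝ) (J : ℕ) (a : ℕ → ℂ) (W : Submodule ℂ (ℝ → ℂ)) :
    Submodule ℝ (((ℝ → ℝ → ℂ) × (ℝ → ℝ → ℂ)) × ((ℝ → ℝ → ℂ) × (ℝ → ℝ → ℂ))) where
  carrier := {v | IsTrajectory T L J a v.1.1 v.1.2 ∧ IsTrajectory T L J a v.2.1 v.2.2 ∧
    v.1.2 0 = 0 ∧ v.2.2 0 = 0 ∧ v.1.2 L = v.2.2 L ∧ v.1.2 L ∈ W}
  zero_mem' := ⟨IsTrajectory.zero T L J a, IsTrajectory.zero T L J a, rfl, rfl, rfl, W.zero_mem⟩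
  add_mem' := by
    rintro v w ⟨h1, h2, h3, h4, h5, h6⟩ ⟨k1, k2, k3, k4, k5, k6⟩
    refine ⟨h1.add k1, h2.add k2, ?_, ?_, ?_, W.add_mem h6 k6⟩
    · simp [h3, k3]
    · simp [h4, k4]
    · simp [h5, k5]
  smul_mem' := by
    rintro c v ⟨h1, h2, h3, h4, h5, h6⟩
    have hsm : ∀ f : ℝ → ℝ → ℂ, c • f = (c : ℂ) • f := fun f => by
      funext z t
      simp
    simp only [mem_ofPred_eq, Prod.smul_fst, Prod.smul_snd, hsm]
    refine ⟨h1.smul _, h2.smul _, ?_, ?_, ?_, W.smul_mem _ h6⟩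
    · simp [h3]
    · simp [h4]
    · simp [h5]

/-- The linear functional `Re ∫ f^* ν`, `ν` the control of a variation. -/
noncomputable def pairingFunctional {V : Type*} [AddCommGroup V] [Module ℝ V] {T L : ℝ}
    (hL : 0 ≤ L) {f : ℝ → ℝ → ℂ}
    (hf : ContinuousOn (fun w : ℝ × ℝ => f w.1 w.2) (Icc 0 L ×ˢ univ))
    (c : V →ₗ[ℝ] (ℝ → ℝ → ℂ))
    (hc : ∀ v, ContinuousOn (fun w : ℝ × ℝ => c v w.1 w.2) (Icc 0 L ×ˢ univ)) : V →ₗ[ℝ] ℝ where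
  toFun v := (pairing T L f (c v)).re
  map_add' v w := by
    rw [map_add, pairing_add_right hL hf (hc v) (hc w), Complex.add_re]
  map_smul' r v := by
    have hsm : r • c v = (r : ℂ) • c v := by
      funext z t
      simp
    rw [map_smul, hsm, pairing_smul_right, Complex.re_ofReal_mul]
    simp

theorem advDist_le {T L : ℝ} (hT : 0 ≤ T) (hL : 0 ≤ L) {J : ℕ} {a : ℕ → ℂ}
    {W : Submodule ℂ (ℝ → ℂ)} {n₁ n₂ q p : ℝ → ℝ → ℂ} (hq : IsTrajectory T L J a n₁ q)
    (hp : IsTrajectory T L J a n₂ p) (hend : q L = p L) (hmem : q L ∈ W) :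
    advDist T L J a W (q 0) (p 0) ≤ max (effort T L n₁) (effort T L n₂) := by
  refine csInf_le ⟨0, ?_⟩ ⟨q L, ?_, ?_⟩
  · rintro E ⟨y, hy, -⟩
    simp only [noiseBall, mem_iUnion] at hy
    obtain ⟨ε, hε, -, n, -, -, -, -, rfl⟩ := hy
    exact (effort_nonneg hT hL n).trans hε
  · simp only [noiseBall, mem_iUnion]
    exact ⟨_, le_max_left _ _, hmem, n₁, q, hq, rfl, rfl, rfl⟩
  · simp only [noiseBall, mem_iUnion]
    exact ⟨_, le_max_right _ _, hmem, n₂, p, hp, rfl, hend.symm, rfl⟩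

theorem IsMinimizingPair.exists_multipliers {T L : ℝ} (hT : 0 < T) (hL : 0 < L) {J : ℕ}
    {a : ℕ → ℂ} {W : Submodule ℂ (ℝ → ℂ)} {x₁ x₂ : ℝ → ℂ} {n₁ n₂ q p : ℝ → ℝ → ℂ}
    (h : IsMinimizingPair T L J a W x₁ x₂ n₁ n₂ q p) :
    ∃ μ₁ μ₂ : ℝ, 0 ≤ μ₁ ∧ 0 ≤ μ₂ ∧ μ₁ + μ₂ = 1 ∧
      μ₁ * (advDist T L J a W x₁ x₂ - effort T L n₁) = 0 ∧
      μ₂ * (advDist T L J a W x₁ x₂ - effort T L n₂) = 0 ∧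
      ∀ ν₁ δ₁ ν₂ δ₂, IsTrajectory T L J a ν₁ δ₁ → IsTrajectory T L J a ν₂ δ₂ → δ₁ 0 = 0 →
        δ₂ 0 = 0 → δ₁ L = δ₂ L → δ₁ L ∈ W →
        μ₁ * (pairing T L n₁ ν₁).re + μ₂ * (pairing T L n₂ ν₂).re = 0 := by
  let c₁ : variations T L J a W →ₗ[ℝ] (ℝ → ℝ → ℂ) :=
    LinearMap.fst ℝ _ _ ∘ₗ LinearMap.fst ℝ _ _ ∘ₗ Submodule.subtype _
  let c₂ : variations T L J a W →ₗ[ℝ] (ℝ → ℝ → ℂ) :=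
    LinearMap.fst ℝ _ _ ∘ₗ LinearMap.snd ℝ _ _ ∘ₗ Submodule.subtype _
  have hn₁ := h.left.continuousOn_noise
  have hn₂ := h.right.continuousOn_noise
  obtain ⟨μ₁, μ₂, p1, p2, h1, h2, h3, h4⟩ := LinearChannel.exists_multipliers
    (pairingFunctional (T := T) hL.le hn₁ c₁ fun v => v.2.1.continuousOn_noise)
    (pairingFunctional (T := T) hL.le hn₂ c₂ fun v => v.2.2.1.continuousOn_noise)
    h.left_effort h.right_effort (by
      rintro ⟨⟨⟨ν₁, δ₁⟩, ⟨ν₂, δ₂⟩⟩, k1, k2, k3, k4, k5, k6⟩ ⟨e1, e2⟩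
      obtain ⟨ε, e1, e2⟩ :=
        ((eventually_effort_lt hL.le hn₁ k1.continuousOn_noise h.left_effort e1).and
        (eventually_effort_lt hL.le hn₂ k2.continuousOn_noise h.right_effort e2)).exists
      have hle := advDist_le (W := W) hT.le hL.le (h.left.add (k1.smul (ε : ℂ)))
        (h.right.add (k2.smul (ε : ℂ)))
        (by simp only [Pi.add_apply, Pi.smul_apply, h.end_eq]; exact congrArg _ (congrArg _ k5))
        (W.add_mem h.end_mem (W.smul_mem _ k6))
      have s1 : (q + (ε : ℂ) • δ₁) 0 = x₁ := by
        rw [Pi.add_apply, Pi.smul_apply, show δ₁ 0 = 0 from k3, h.left_start, smul_zero, add_zero]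
      have s2 : (p + (ε : ℂ) • δ₂) 0 = x₂ := by
        rw [Pi.add_apply, Pi.smul_apply, show δ₂ 0 = 0 from k4, h.right_start, smul_zero,
          add_zero]
      rw [s1, s2] at hle
      exact absurd hle (not_le.2 (max_lt e1 e2)))
  exact ⟨μ₁, μ₂, p1, p2, h1, h2, h3, fun ν₁ δ₁ ν₂ δ₂ k1 k2 k3 k4 k5 k6 =>
    h4 ⟨((ν₁, δ₁), (ν₂, δ₂)), k1, k2, k3, k4, k5, k6⟩⟩

/-! ### The modes of a minimizing pair -/

/-- Parseval on both sides. -/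
theorem integral_norm_sq_of_fourierCoeffOn {T : ℝ} (hT : 0 < T) {f g : ℝ → ℂ} (hf : Continuous f)
    (hg : Continuous g) {c c' : ℝ}
    (h : ∀ m, c * ‖fourierCoeffOn (neg_lt_self hT) f m‖ ^ 2
      = c' * ‖fourierCoeffOn (neg_lt_self hT) g m‖ ^ 2) :
    c * ∫ t in (-T)..T, ‖f t‖ ^ 2 = c' * ∫ t in (-T)..T, ‖g t‖ ^ 2 := by
  have h1 := (hasSum_sq_fourierCoeffOn_continuous hT hf).mul_left c
  have h2 := (hasSum_sq_fourierCoeffOn_continuous hT hg).mul_left c'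
  simp only [h] at h1
  have h3 := h1.unique h2
  rw [mul_left_comm, mul_left_comm c'] at h3
  exact mul_left_cancel₀ (by positivity) h3

theorem effort_of_fourierCoeffOn {T L : ℝ} (hT : 0 < T) (hL : 0 ≤ L) {f g : ℝ → ℝ → ℂ}
    (hf : ContinuousOn (fun w : ℝ × ℝ => f w.1 w.2) (Icc 0 L ×ˢ univ))
    (hg : ContinuousOn (fun w : ℝ × ℝ => g w.1 w.2) (Icc 0 L ×ˢ univ)) {c c' : ℝ}
    (h : ∀ z ∈ Icc 0 L, ∀ m, c * ‖fourierCoeffOn (neg_lt_self hT) (f z) m‖ ^ 2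
      = c' * ‖fourierCoeffOn (neg_lt_self hT) (g z) m‖ ^ 2) :
    c * effort T L f = c' * effort T L g := by
  unfold effort
  rw [← intervalIntegral.integral_const_mul, ← intervalIntegral.integral_const_mul]
  refine intervalIntegral.integral_congr fun z hz => ?_
  rw [uIcc_of_le hL] at hz
  exact integral_norm_sq_of_fourierCoeffOn hT (slice_continuous hf hz) (slice_continuous hg hz)
    (h z hz)

theorem fourierCoeffOn_eq_zero_of_effort {T L : ℝ} (hT : 0 < T) (hL : 0 < L) {f : ℝ → ℝ → ℂ}
    (hf : ContinuousOn (fun w : ℝ × ℝ => f w.1 w.2) (Icc 0 L ×ˢ univ)) (h0 : effort T L f = 0)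
    (m : ℤ) {z : ℝ} (hz : z ∈ Icc 0 L) : fourierCoeffOn (neg_lt_self hT) (f z) m = 0 := by
  have hc : ContinuousOn (fun z => ∫ t in (-T)..T, ‖f z t‖ ^ 2) (Icc 0 L) :=
    intervalIntegral_continuousOn hL.le _ _ (hf.norm.pow 2)
  have hnn : ∀ z, 0 ≤ ∫ t in (-T)..T, ‖f z t‖ ^ 2 := fun z =>
    intervalIntegral.integral_nonneg (by linarith) fun _ _ => by positivity
  have hzero : ∫ t in (-T)..T, ‖f z t‖ ^ 2 = 0 := by
    by_contra hne
    exact (intervalIntegral.integral_pos hL hc (fun z _ => hnn z)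
      ⟨z, hz, lt_of_le_of_ne (hnn z) (Ne.symm hne)⟩).ne' h0
  have hs := hasSum_sq_fourierCoeffOn_continuous hT (slice_continuous hf hz)
  rw [hzero, mul_zero, hasSum_zero_iff_of_nonneg fun _ => by positivity] at hs
  simpa using congrFun hs m

/-- The controls of a minimizing pair satisfy the Euler-Lagrange equation, and their Fourier
coefficients are opposite. -/
theorem IsMinimizingPair.fourierCoeffOn_noise {T L : ℝ} (hT : 0 < T) (hL : 0 < L) {J : ℕ}
    {a : ℕ → ℂ} {W : Submodule ℂ (ℝ → ℂ)} (hW : alphabet T J ≤ W) {x₁ x₂ : ℝ → ℂ}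
    {n₁ n₂ q p : ℝ → ℝ → ℂ} (h : IsMinimizingPair T L J a W x₁ x₂ n₁ n₂ q p) (m : ℤ) :
    ∃ β : ℂ, ∀ z ∈ Icc 0 L,
      fourierCoeffOn (neg_lt_self hT) (n₁ z) m
        = β * Complex.exp (-(conj (symbol T J a m)) * z) ∧
      fourierCoeffOn (neg_lt_self hT) (n₂ z) m
        = -β * Complex.exp (-(conj (symbol T J a m)) * z) := by
  obtain ⟨μ₁, μ₂, -, -, hμ, hd₁, hd₂, hstat⟩ := h.exists_multipliers hT hL
  set d := advDist T L J a W x₁ x₂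
  have hn₁ := h.left.continuousOn_noise
  have hn₂ := h.right.continuousOn_noise
  have hc₁ : ContinuousOn (fun w : ℝ × ℝ => ((μ₁ : ℂ) • n₁) w.1 w.2) (Icc 0 L ×ˢ univ) :=
    continuousOn_const.mul hn₁
  have hc₂ : ContinuousOn (fun w : ℝ × ℝ => ((μ₂ : ℂ) • n₂) w.1 w.2) (Icc 0 L ×ˢ univ) :=
    continuousOn_const.mul hn₂
  have hzero : ∀ m, ∀ z ∈ Icc 0 L, μ₁ * fourierCoeffOn (neg_lt_self hT) (n₁ z) m
      + μ₂ * fourierCoeffOn (neg_lt_self hT) (n₂ z) m = 0 := fun m z hz => by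
    have h1 := fourierCoeffOn_eq_zero_of_stationary hT hL (J := J) (a := a)
      (f := (μ₁ : ℂ) • n₁ + (μ₂ : ℂ) • n₂) (hc₁.add hc₂)
      (fun ν δ ht h0 hmem => ?_) m hz
    · rw [← h1]
      have hce := Complex.continuous_conj.comp (continuous_expMode T m)
      have hi₁ : IntervalIntegrable (fun t => conj (expMode T m t) * (μ₁ * n₁ z t)) volume
        (-T) T := (hce.mul (continuous_const.mul (slice_continuous hn₁ hz))).intervalIntegrable _ _
      have hi₂ : IntervalIntegrable (fun t => conj (expMode T m t) * (μ₂ * n₂ z t)) volume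
        (-T) T := (hce.mul (continuous_const.mul (slice_continuous hn₂ hz))).intervalIntegrable _ _
      simp only [fourierCoeffOn_eq_expMode hT, Pi.add_apply, Pi.smul_apply, smul_eq_mul, mul_add]
      rw [intervalIntegral.integral_add hi₁ hi₂]
      simp only [mul_left_comm (conj _), intervalIntegral.integral_const_mul]
      ring
    -- Using one variation for both trajectories keeps their ends equal.
    · have := hstat ν δ ν δ ht ht h0 h0 rfl (hW hmem)
      rw [← this]
      rw [pairing_add_left hL.le hc₁ hc₂ ht.continuousOn_noise, pairing_smul_left,
        pairing_smul_left]
      simp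
  have hE : μ₁ ^ 2 * effort T L n₁ = μ₂ ^ 2 * effort T L n₂ :=
    effort_of_fourierCoeffOn hT hL.le hn₁ hn₂ fun z hz m => by
      have := congrArg (‖·‖ ^ 2) (eq_neg_of_add_eq_zero_left (hzero m z hz))
      simpa [mul_pow] using this
  -- Slackness replaces both efforts in `hE` by `d`; then `μ₁ + μ₂ = 1` removes a factor from `μ₁² -
  -- μ₂²`.
  have hcase : d * (μ₁ - μ₂) = 0 := by
    linear_combination hE + μ₁ * hd₁ - μ₂ * hd₂ - d * (μ₁ - μ₂) * hμ
  rcases mul_eq_zero.1 hcase with hd | hd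
  · have hz₁ : effort T L n₁ = 0 :=
      le_antisymm (h.left_effort.trans hd.le) (effort_nonneg hT.le hL.le _)
    have hz₂ : effort T L n₂ = 0 :=
      le_antisymm (h.right_effort.trans hd.le) (effort_nonneg hT.le hL.le _)
    exact ⟨0, fun z hz => by simp [fourierCoeffOn_eq_zero_of_effort hT hL hn₁ hz₁ m hz,
      fourierCoeffOn_eq_zero_of_effort hT hL hn₂ hz₂ m hz]⟩
  · have h1 : μ₁ = 1 / 2 := by linarith
    have h2 : μ₂ = 1 / 2 := by linarith
    refine ⟨fourierCoeffOn (neg_lt_self hT) (n₁ 0) m, fun z hz => ?_⟩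
    -- Only the first trajectory varies here, with fixed ends.
    have hEL := fourierCoeffOn_of_stationary hT hL (J := J) (a := a) hn₁
      (fun ν δ ht h0 hend => by
        have := hstat ν δ 0 0 ht (IsTrajectory.zero T L J a) h0 rfl hend
          (hend ▸ W.zero_mem)
        have hp0 : pairing T L n₂ 0 = 0 := by simp [pairing]
        rw [h1, hp0] at this
        simpa using this) m hz
    refine ⟨hEL, ?_⟩
    have := hzero m z hz
    rw [h1, h2] at this
    rw [neg_mul, ← hEL, eq_neg_iff_add_eq_zero]
    push_cast at this
    linear_combination 2 * this

/-- The coefficient of the mode with the control `β e^{-r^* z}`. -/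
noncomputable def modeCoeff (r β : ℂ) : ℂ :=
  open Classical in
  if r.re = 0 then β else -β / (2 * r.re)

/-- The solution of `u' = r u + β e^{-r^* z}` is a mode. -/
theorem eq_mode {L : ℝ} {r β : ℂ} {u : ℝ → ℂ}
    (hu : ∀ z ∈ Icc 0 L, HasDerivWithinAt u
      (r * u z + β * Complex.exp (-(conj r) * z)) (Icc 0 L) z) :
    ∃ A, ∀ z ∈ Icc 0 L, u z = mode r A (modeCoeff r β) z := by
  have hexp : ∀ (s : ℂ) (z : ℝ),
      HasDerivAt (fun z : ℝ => Complex.exp (s * z)) (s * Complex.exp (s * z)) z := fun s z => by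
    have h := ((Complex.ofRealCLM.hasDerivAt (x := z)).const_mul s).cexp
    simpa [mul_comm] using h
  have hid : ∀ z : ℝ, HasDerivAt (fun z : ℝ => (z : ℂ)) 1 z := fun z => by
    simpa using (hasDerivAt_id z).ofReal_comp
  have hmode : ∀ (A : ℂ) (z : ℝ), HasDerivAt (mode r A (modeCoeff r β))
      (r * mode r A (modeCoeff r β) z + β * Complex.exp (-(conj r) * z)) z := fun A z => by
    by_cases hr : r.re = 0
    · have hm : mode r A (modeCoeff r β) = fun z : ℝ => (A + β * z) * Complex.exp (r * z) := by
        funext z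
        simp only [mode, modeCoeff, if_pos hr]
      -- Resonance: the forcing solves the homogeneous equation, hence the factor `z`.
      have hconj : -(conj r) = r := by
        apply Complex.ext <;> simp [hr]
      rw [hm, hconj]
      refine ((((hid z).const_mul β).const_add A).mul (hexp r z)).congr_deriv ?_
      ring
    · have hm : mode r A (modeCoeff r β) = fun z : ℝ => A * Complex.exp (r * z)
          + -β / (2 * r.re) * Complex.exp (-(conj r) * z) := by
        funext z
        simp only [mode, modeCoeff, if_neg hr]
      rw [hm]
      refine (((hexp r z).const_mul A).add ((hexp _ z).const_mul _)).congr_deriv ?_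
      have hr' : (r.re : ℂ) ≠ 0 := by exact_mod_cast hr
      have h2 : conj r = 2 * r.re - r := by
        rw [eq_sub_iff_add_eq, add_comm, Complex.add_conj]
        push_cast
        ring
      rw [h2]
      beta_reduce
      generalize Complex.exp (-(2 * r.re - r) * z) = e
      field_simp
      ring
  obtain ⟨A, hA⟩ : ∃ A, mode r A (modeCoeff r β) 0 = u 0 := by
    by_cases hr : r.re = 0
    · exact ⟨u 0, by simp [mode, hr]⟩
    · exact ⟨u 0 - modeCoeff r β, by simp [mode, hr]⟩
  refine ⟨A, fun z hz => ?_⟩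
  -- The difference solves `v' = r v`, so `v e^{-r z}` is constant; it vanishes at 0 by the choice
  -- of `A`.
  have hD : ∀ z ∈ Icc 0 L, HasDerivWithinAt
      (fun z : ℝ => (u z - mode r A (modeCoeff r β) z) * Complex.exp (-r * z)) 0 (Icc 0 L) z :=
    fun z hz => by
      refine (((hu z hz).sub (hmode A z).hasDerivWithinAt).mul
        (hexp (-r) z).hasDerivWithinAt).congr_deriv ?_
      simp only [Pi.sub_apply]
      ring
  have hconst := constant_of_has_deriv_right_zero (fun z hz => (hD z hz).continuousWithinAt)
    (fun z hz => (hD z (Ico_subset_Icc_self hz)).mono_of_mem_nhdsWithin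
      (Icc_mem_nhdsGE_of_mem hz)) z hz
  rw [hA, sub_self, zero_mul, mul_eq_zero, or_iff_left (Complex.exp_ne_zero _)] at hconst
  exact sub_eq_zero.1 hconst

theorem modeCoeff_neg (r β : ℂ) : modeCoeff r (-β) = -modeCoeff r β := by
  unfold modeCoeff
  split_ifs <;> ring

end LinearChannel

/-- `Q_m`, `P_m`, `X_m` are the Fourier coefficients
`(1/2T) ∫_{-T}^T (·) e^{-i ω_m t} dt`, `ω_m = m π / T`. The alphabet `W` may be the one of the
waveforms that vanish at `± T` with all derivatives, or any larger linear space. -/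
theorem mainTheorem7 (T L : ℝ) (hT : 0 < T) (hL : 0 < L) (J : ℕ) (a : ℕ → ℂ)
    (W : Submodule ℂ (ℝ → ℂ)) (hW : LinearChannel.alphabet T J ≤ W)
    (x₁ x₂ : ℝ → ℂ) (hx₁ : x₁ ∈ W) (hx₂ : x₂ ∈ W) (n₁ n₂ q p : ℝ → ℝ → ℂ)
    (hmin : LinearChannel.IsMinimizingPair T L J a W x₁ x₂ n₁ n₂ q p) :
    let R : ℤ → ℂ := LinearChannel.symbol T J a
    let Q : ℤ → ℝ → ℂ := fun m z => fourierCoeffOn (neg_lt_self hT) (q z) m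
    let P : ℤ → ℝ → ℂ := fun m z => fourierCoeffOn (neg_lt_self hT) (p z) m
    let X₁ : ℤ → ℂ := fourierCoeffOn (neg_lt_self hT) x₁
    let X₂ : ℤ → ℂ := fourierCoeffOn (neg_lt_self hT) x₂
    ∃ (A B C D : ℤ → ℂ) (μ : ℝ),
      (∀ m, ∀ z ∈ Set.Icc 0 L, Q m z = LinearChannel.mode (R m) (A m) (B m) z) ∧
      (∀ m, ∀ z ∈ Set.Icc 0 L, P m z = LinearChannel.mode (R m) (C m) (D m) z) ∧
      (∀ m, Q m 0 = X₁ m) ∧ (∀ m, P m 0 = X₂ m) ∧ (∀ m, Q m L = P m L) ∧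
      (∀ m, (1 - μ : ℂ) * B m + μ * D m = 0) ∧
      HasSum (fun m => LinearChannel.weight L 1 (R m) * (‖B m‖ ^ 2 - ‖D m‖ ^ 2)) 0 ∧
      HasSum (fun m => LinearChannel.weight L (-L) (R m) * (‖B m‖ ^ 2 - ‖D m‖ ^ 2)) 0 := by
  intro R Q P X₁ X₂
  choose β hβ using fun m => hmin.fourierCoeffOn_noise hT hL hW m
  choose A hA using fun m => LinearChannel.eq_mode (L := L) (r := R m) (β := β m) (u := Q m)
    fun z hz => by
      rw [← (hβ m z hz).1]
      exact hmin.left.hasDerivWithinAt_fourierCoeffOn hT hL m hz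
  choose C hC using fun m => LinearChannel.eq_mode (L := L) (r := R m) (β := -β m) (u := P m)
    fun z hz => by
      rw [← (hβ m z hz).2]
      exact hmin.right.hasDerivWithinAt_fourierCoeffOn hT hL m hz
  simp only [LinearChannel.modeCoeff_neg] at hC
  -- Opposite controls give `D = -B`, so `μ = 1/2` serves every `m`.
  refine ⟨A, fun m => LinearChannel.modeCoeff (R m) (β m), C,
    fun m => -LinearChannel.modeCoeff (R m) (β m), 1 / 2, hA, hC, fun m => ?_, fun m => ?_,
    fun m => ?_, fun m => ?_, ?_, ?_⟩
  · simp only [Q, X₁, hmin.left_start]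
  · simp only [P, X₂, hmin.right_start]
  · simp only [Q, P, hmin.end_eq]
  · push_cast
    ring
  · simp only [norm_neg, sub_self, mul_zero, hasSum_zero]
  · simp only [norm_neg, sub_self, mul_zero, hasSum_zero]
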